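/- Let $n\ge 1$ and let $\mathfrak g$ be of type $B_n$, $C_n$ or $D_n$, i.e. $\mathfrak g=\mathfrak{so}_{2n+1},\mathfrak{sp}_{2n}$ or $\mathfrak{so}_{2n}$. Let $(\varepsilon_1,\dots,\varepsilon_n)$ be the standard basis of $\mathbb Q^n$ and let $$R^+=\{\varepsilon_i\pm\varepsilon_j : 1\le i<j\le n\}\cup E,$$ where $E=\{\varepsilon_i : 1\le i\le n\}$ in type $B$, $E=\{2\varepsilon_i : 1\le i\le n\}$ in type $C$, and $E=\emptyset$ in type $D$. Let $\rho=\frac12\sum_{\alpha\in R^+}\alpha$. Let $W$ be the Weyl group, realized as the group of signed permutations generated by $s_i=(i,i+1)(\overline{i},\overline{i+1})$ for $1\le i<n$ together with $(n,\overline{n})$ in types $B$ and $C$, and together with $(n,\overline{n-1})(n-1,\overline{n})$ in type $D$ if $n\ge 2$. Let $\ell$ be the length function of $W$ with respect to these generators. The group $W$ acts on $\mathbb Q^n$ by $(w\cdot\beta)_i=\beta_{w^{-1}(i)}$, with $\beta_{\overline{j}}=-\beta_j$, and we put $w\circ\beta=w\cdot(\beta+\rho)-\rho$. For $\beta\in\mathbb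 Q^n$ let $$\mathcal P_q(\beta)=\sum_{k\ge 0}\mathcal P^k(\beta)\,q^k,$$ where $\mathcal P^k(\beta)$ is the number of ways of writing $\beta$ as a sum of $k$ elements of $R^+$ (unordered, repetitions allowed); equivalently, $\mathcal P_q(\beta)$ is the coefficient of $e^\beta$ in $\prod_{\alpha\in R^+}(1-qe^\alpha)^{-1}$. Let $\mathcal P_n$ be the set of partitions with at most $n$ nonzero parts, written as sequences $(\nu_1\ge\dots\ge\nu_n\ge 0)$ of integers, and let $|\nu|=\nu_1+\dots+\nu_n$. For $\nu,\mu\in\mathcal P_n$ the Lusztig $q$-analogue of weight multiplicity is the polynomial $$K^{\mathfrak g}_{\nu,\mu}(q)=\sum_{w\in W}(-1)^{\ell(w)}\,\mathcal P_q(w\circ\nu-\mu)\in\mathbb Z[q].$$ Then for all $\nu,\mu\in\mathcal P_n$, either $K^{\mathfrak g}_{\nu,\mu}(q)=0$, or the lowest degree of a monomial occurring in $K^{\mathfrak g}_{\nu,\mu}(q)$ with nonzero coefficient is at least $\dfrac{|\nu|-|\mu|}{2}$. -/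

import Mathlib

open Polynomial

namespace ClassicalType

/-- The three families of classical Lie algebras: `B` is `so_{2n+1}`, `C` is `sp_{2n}`,
`D` is `so_{2n}`, where `n` is the rank. -/
inductive CType where
  | B
  | C
  | D

/-- The basis vector `ε_i` of the space of weights, identified with `ℚ^n`. -/
def eps {n : ℕ} (i : Fin n) : Fin n → ℚ := Pi.single i 1

/-- The roots `2 ε_i` or `ε_i` (or none) which distinguish the types. -/
def extraRoots (X : CType) (n : ℕ) : Finset (Fin n → ℚ) :=
  match X with
  | CType.B => Finset.univ.image (fun i : Fin n => eps i)
  | CType.C => Finset.univ.image (fun i : Fin n => (2 : ℚ) • eps i)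
  | CType.D => ∅

/-- The set `R⁺` of positive roots of the root system `X_n`. -/
def positiveRoots (X : CType) (n : ℕ) : Finset (Fin n → ℚ) :=
  ((Finset.univ.filter fun p : Fin n × Fin n => p.1 < p.2).image
      fun p => eps p.1 - eps p.2) ∪
  ((Finset.univ.filter fun p : Fin n × Fin n => p.1 < p.2).image
      fun p => eps p.1 + eps p.2) ∪
  extraRoots X n

/-- Half the sum of the positive roots. -/
def rho (X : CType) (n : ℕ) : Fin n → ℚ := (1 / 2 : ℚ) • ∑ α ∈ positiveRoots X n, α

/-- The Coxeter generators of the Weyl group, as permutations of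
`{1, …, n} ∪ {1̄, …, n̄}`; here `Sum.inl i` stands for `i` and `Sum.inr i` for `ī`.
They are `s_i = (i, i+1)(ī, (i+1)‾)` for `1 ≤ i < n`, together with `s_n = (n, n̄)` in types
`B` and `C`, and with `s_n' = (n, (n-1)‾)(n-1, n̄)` in type `D`. -/
def simpleReflections (X : CType) (n : ℕ) : Set (Equiv.Perm (Fin n ⊕ Fin n)) :=
  {s | ∃ i j : Fin n, (i : ℕ) + 1 = j ∧
      s = Equiv.swap (Sum.inl i) (Sum.inl j) * Equiv.swap (Sum.inr i) (Sum.inr j)} ∪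
  match X with
  | CType.B => {s | ∃ i : Fin n, (i : ℕ) + 1 = n ∧ s = Equiv.swap (Sum.inl i) (Sum.inr i)}
  | CType.C => {s | ∃ i : Fin n, (i : ℕ) + 1 = n ∧ s = Equiv.swap (Sum.inl i) (Sum.inr i)}
  | CType.D => {s | ∃ i j : Fin n, (i : ℕ) + 1 = j ∧ (j : ℕ) + 1 = n ∧
      s = Equiv.swap (Sum.inl j) (Sum.inr i) * Equiv.swap (Sum.inl i) (Sum.inr j)}

/-- The Weyl group. -/
def weylGroup (X : CType) (n : ℕ) : Subgroup (Equiv.Perm (Fin n ⊕ Fin n)) :=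
  Subgroup.closure (simpleReflections X n)

/-- The length `ℓ(w)`: the least length of a word in the generators with product `w`. -/
noncomputable def length (X : CType) (n : ℕ) (w : Equiv.Perm (Fin n ⊕ Fin n)) : ℕ :=
  sInf {k | ∃ l : List (Equiv.Perm (Fin n ⊕ Fin n)),
    (∀ s ∈ l, s ∈ simpleReflections X n) ∧ l.prod = w ∧ l.length = k}

/-- The linear action of signed permutations on weights,
`(w · β)_i = β_{w⁻¹(i)}`, with the convention `β_{j̄} = -β_j`. -/
def act {n : ℕ} (w : Equiv.Perm (Fin n ⊕ Fin n)) (β : Fin n → ℚ) : Fin n → ℚ :=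
  fun i => Sum.elim β (fun j => -β j) (w⁻¹ (Sum.inl i))

/-- The dot action `w ∘ β = w · (β + ρ) - ρ`. -/
def dotAct (X : CType) {n : ℕ} (w : Equiv.Perm (Fin n ⊕ Fin n)) (β : Fin n → ℚ) :
    Fin n → ℚ :=
  act w (β + rho X n) - rho X n

/-- The ways of writing `β` as a sum of positive roots: `m α` is the multiplicity of `α`. -/
def rootDecompositions (X : CType) (n : ℕ) (β : Fin n → ℚ) :
    Set ({α // α ∈ positiveRoots X n} → ℕ) :=
  {m | ∑ α, (m α : ℚ) • α.1 = β}

/-- A linear functional that is at least `1` on every positive root. -/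
lemma one_le_functional (X : CType) (n : ℕ) {α : Fin n → ℚ} (h : α ∈ positiveRoots X n) :
    1 ≤ ∑ i : Fin n, ((n : ℚ) - (i : ℕ)) * α i := by
  have key : ∀ i : Fin n, ∑ j : Fin n, ((n : ℚ) - (j : ℕ)) * eps i j = n - (i : ℕ) := by
    intro i
    simp [eps, Pi.single_apply]
  have hi : ∀ i : Fin n, (1 : ℚ) ≤ n - (i : ℕ) := by
    intro i
    have : ((i : ℕ) : ℚ) + 1 ≤ n := by exact_mod_cast i.2
    linarith
  simp only [positiveRoots, Finset.mem_union, Finset.mem_image, Finset.mem_filter,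
    Finset.mem_univ, true_and, Prod.exists] at h
  rcases h with (⟨i, j, hij, rfl⟩ | ⟨i, j, -, rfl⟩) | h
  · simp only [Pi.sub_apply, mul_sub, Finset.sum_sub_distrib, key]
    have : ((i : ℕ) : ℚ) + 1 ≤ (j : ℕ) := by exact_mod_cast hij
    linarith
  · simp only [Pi.add_apply, mul_add, Finset.sum_add_distrib, key]
    linarith [hi i, hi j]
  · cases X with
    | B =>
      simp only [extraRoots, Finset.mem_image, Finset.mem_univ, true_and] at h
      obtain ⟨i, rfl⟩ := h
      rw [key]
      exact hi i
    | C =>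
      simp only [extraRoots, Finset.mem_image, Finset.mem_univ, true_and] at h
      obtain ⟨i, rfl⟩ := h
      simp only [Pi.smul_apply, smul_eq_mul, mul_left_comm _ (2 : ℚ), ← Finset.mul_sum, key]
      linarith [hi i]
    | D => simp [extraRoots] at h

lemma rootDecompositions_finite (X : CType) (n : ℕ) (β : Fin n → ℚ) :
    (rootDecompositions X n β).Finite := by
  obtain ⟨N, hN⟩ := exists_nat_ge (∑ i : Fin n, ((n : ℚ) - (i : ℕ)) * β i)
  refine (Set.finite_Iic (fun _ : {α // α ∈ positiveRoots X n} => N)).subset ?_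
  intro m hm α
  have hβ : ∑ i : Fin n, ((n : ℚ) - (i : ℕ)) * β i =
      ∑ α : {α // α ∈ positiveRoots X n},
        (m α : ℚ) * ∑ i : Fin n, ((n : ℚ) - (i : ℕ)) * α.1 i := by
    rw [← (show ∑ α, (m α : ℚ) • α.1 = β from hm)]
    simp only [Finset.sum_apply, Pi.smul_apply, smul_eq_mul, Finset.mul_sum]
    rw [Finset.sum_comm]
    refine Finset.sum_congr rfl fun a _ => Finset.sum_congr rfl fun i _ => ?_
    ring
  have h1 : (m α : ℚ) ≤ ∑ α : {α // α ∈ positiveRoots X n},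
      (m α : ℚ) * ∑ i : Fin n, ((n : ℚ) - (i : ℕ)) * α.1 i := by
    have hge : ∀ a : {α // α ∈ positiveRoots X n},
        (m a : ℚ) ≤ (m a : ℚ) * ∑ i : Fin n, ((n : ℚ) - (i : ℕ)) * a.1 i := fun a =>
      le_mul_of_one_le_right (Nat.cast_nonneg _) (one_le_functional X n a.2)
    exact (hge α).trans (Finset.single_le_sum
      (f := fun a => (m a : ℚ) * ∑ i : Fin n, ((n : ℚ) - (i : ℕ)) * a.1 i)
      (fun a _ => (Nat.cast_nonneg _).trans (hge a)) (Finset.mem_univ α))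
  have : (m α : ℚ) ≤ N := by linarith
  exact_mod_cast this

/-- The `q`-analogue `P_q(β)` of Kostant's partition function, that is, the coefficient of
`e^β` in `∏_{α ∈ R⁺} (1 - q e^α)⁻¹`; each decomposition of `β` into `k` positive roots
contributes `q^k`. -/
noncomputable def kostantPartition (X : CType) (n : ℕ) (β : Fin n → ℚ) : ℤ[X] :=
  ∑ m ∈ (rootDecompositions_finite X n β).toFinset, Polynomial.X ^ (∑ α, m α)

open Classical in
/-- The Lusztig `q`-analogue of weight multiplicity
`K_{ν,μ}(q) = ∑_{w ∈ W} (-1)^{ℓ(w)} P_q(w ∘ ν - μ)`. -/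
noncomputable def lusztigQ (X : CType) (n : ℕ) (ν μ : Fin n → ℕ) : ℤ[X] :=
  ∑ w : weylGroup X n, (-1) ^ length X n w.1 *
    kostantPartition X n (dotAct X w.1 (fun i => (ν i : ℚ)) - fun i => (μ i : ℚ))

end ClassicalType

/-!
The bound already holds for every summand `P_q(w ∘ ν - μ)`, so no cancellation between the
summands has to be understood. The reason is the `ℓ¹`-norm `‖β‖₁ = ∑ |β_i|` on `ℚ^n`:
signed permutations preserve it (`sum_abs_act`), every root has norm at most `2`
(`sum_abs_le_two`), and `ρ`, `ν`, `μ` have nonnegative coordinates (`rho_nonneg`), so that their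
norms are the sums of their coordinates. Hence, if `w ∘ ν - μ = w · (ν + ρ) - (ρ + μ)` is a sum of
`k` positive roots, then `2 k ≥ ‖w · (ν + ρ)‖₁ - ‖ρ + μ‖₁ = ‖ν + ρ‖₁ - ‖ρ + μ‖₁ = |ν| - |μ|`.
-/

namespace ClassicalType

/-! ### Positive roots and `ρ` -/

lemma sum_abs_eps {n : ℕ} (i : Fin n) : ∑ k, |eps i k| = 1 := by
  simp [eps, Pi.single_apply, apply_ite abs]

lemma sum_abs_le_two (X : CType) (n : ℕ) {α : Fin n → ℚ} (h : α ∈ positiveRoots X n) :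
    ∑ k, |α k| ≤ 2 := by
  simp only [positiveRoots, Finset.mem_union, Finset.mem_image, Finset.mem_filter,
    Finset.mem_univ, true_and, Prod.exists] at h
  rcases h with (⟨i, j, -, rfl⟩ | ⟨i, j, -, rfl⟩) | h
  · calc ∑ k, |(eps i - eps j) k| ≤ ∑ k, (|eps i k| + |eps j k|) :=
          Finset.sum_le_sum fun k _ => abs_sub _ _
      _ = 2 := by rw [Finset.sum_add_distrib, sum_abs_eps, sum_abs_eps]; norm_num
  · calc ∑ k, |(eps i + eps j) k| ≤ ∑ k, (|eps i k| + |eps j k|) :=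
          Finset.sum_le_sum fun k _ => abs_add_le _ _
      _ = 2 := by rw [Finset.sum_add_distrib, sum_abs_eps, sum_abs_eps]; norm_num
  · cases X with
    | B =>
      simp only [extraRoots, Finset.mem_image, Finset.mem_univ, true_and] at h
      obtain ⟨i, rfl⟩ := h
      rw [sum_abs_eps]
      norm_num
    | C =>
      simp only [extraRoots, Finset.mem_image, Finset.mem_univ, true_and] at h
      obtain ⟨i, rfl⟩ := h
      simp only [Pi.smul_apply, smul_eq_mul, abs_mul, ← Finset.mul_sum, sum_abs_eps]
      norm_num
    | D => simp [extraRoots] at h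

/-- A positive root with negative `i`-th coordinate is `ε_a - ε_i`; changing the sign of that
coordinate gives the positive root `ε_a + ε_i`. -/
lemma update_neg_mem_positiveRoots (X : CType) (n : ℕ) (i : Fin n) {α : Fin n → ℚ}
    (h : α ∈ positiveRoots X n) (hi : α i < 0) :
    Function.update α i (-α i) ∈ positiveRoots X n := by
  have hnn : ∀ a b : Fin n, 0 ≤ eps a b := fun a b => by
    rw [eps, Pi.single_apply]; split_ifs <;> norm_num
  have h' := h
  simp only [positiveRoots, Finset.mem_union, Finset.mem_image, Finset.mem_filter,
    Finset.mem_univ, true_and, Prod.exists] at h'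
  rcases h' with (⟨a, b, hab, rfl⟩ | ⟨a, b, -, rfl⟩) | h'
  · have hb : b = i := by
      by_contra hb
      have h0 : eps b i = 0 := by simp [eps, Ne.symm hb]
      have := hnn a i
      simp only [Pi.sub_apply, h0] at hi
      linarith
    subst hb
    simp only [positiveRoots, Finset.mem_union, Finset.mem_image, Finset.mem_filter,
      Finset.mem_univ, true_and, Prod.exists]
    refine Or.inl (Or.inr ⟨a, b, hab, ?_⟩)
    ext k
    by_cases hk : k = b
    · subst hk
      simp [eps, hab.ne']
    · simp [eps, hk]
  · have h1 := hnn a i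
    have h2 := hnn b i
    simp only [Pi.add_apply] at hi
    linarith
  · exfalso
    cases X with
    | B =>
      simp only [extraRoots, Finset.mem_image, Finset.mem_univ, true_and] at h'
      obtain ⟨a, rfl⟩ := h'
      linarith [hnn a i]
    | C =>
      simp only [extraRoots, Finset.mem_image, Finset.mem_univ, true_and] at h'
      obtain ⟨a, rfl⟩ := h'
      simp only [Pi.smul_apply, smul_eq_mul] at hi
      linarith [hnn a i]
    | D => simp [extraRoots] at h'

/-- The negative contributions to the `i`-th coordinate of `2ρ` are cancelled by those of the
positive roots obtained by changing the sign of this coordinate. -/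
lemma rho_nonneg (X : CType) (n : ℕ) (i : Fin n) : 0 ≤ rho X n i := by
  classical
  have key : 0 ≤ ∑ α ∈ positiveRoots X n, α i := by
    set N := (positiveRoots X n).filter fun α => α i < 0 with hN
    let σ : (Fin n → ℚ) → (Fin n → ℚ) := fun α => Function.update α i (-α i)
    have hσ : Function.Involutive σ := fun α => by simp [σ]
    have hσi : ∀ α, σ α i = -α i := fun α => by simp [σ]
    have hdisj : Disjoint N (N.image σ) := by
      rw [Finset.disjoint_left]
      intro α hα hα'
      obtain ⟨β, hβ, rfl⟩ := Finset.mem_image.1 hα'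
      have h1 := (Finset.mem_filter.1 hα).2
      have h2 := (Finset.mem_filter.1 hβ).2
      rw [hσi] at h1
      linarith
    have hsub : N ∪ N.image σ ⊆ positiveRoots X n := by
      refine Finset.union_subset (Finset.filter_subset _ _) fun α hα => ?_
      obtain ⟨β, hβ, rfl⟩ := Finset.mem_image.1 hα
      obtain ⟨h1, h2⟩ := Finset.mem_filter.1 hβ
      exact update_neg_mem_positiveRoots X n i h1 h2
    calc (0 : ℚ) = ∑ α ∈ N ∪ N.image σ, α i := by
          rw [Finset.sum_union hdisj, Finset.sum_image hσ.injective.injOn]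
          simp [hσi]
      _ ≤ ∑ α ∈ positiveRoots X n, α i := by
          refine Finset.sum_le_sum_of_subset_of_nonneg hsub fun α hα hα' => ?_
          by_contra hneg
          exact hα' (Finset.mem_union_left _ (Finset.mem_filter.2 ⟨hα, not_le.1 hneg⟩))
  simp only [rho, Pi.smul_apply, Finset.sum_apply, smul_eq_mul]
  positivity

/-! ### Signed permutations and the `ℓ¹`-norm -/

lemma swap_apply_of_mem_weylGroup (X : CType) (n : ℕ) {w : Equiv.Perm (Fin n ⊕ Fin n)}
    (hw : w ∈ weylGroup X n) (x : Fin n ⊕ Fin n) : w x.swap = (w x).swap := by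
  -- The condition says that `w` lies in the centralizer of the involution `i ↔ ī`.
  let c : Equiv.Perm (Fin n ⊕ Fin n) := Equiv.sumComm _ _
  suffices h : weylGroup X n ≤ Subgroup.centralizer {c} from
    Equiv.congr_fun (Subgroup.mem_centralizer_singleton_iff.1 (h hw)) x
  rw [weylGroup, Subgroup.closure_le]
  intro s hs
  rw [SetLike.mem_coe, Subgroup.mem_centralizer_singleton_iff]
  -- On each generator this is a check of the values at all indices.
  ext1 y
  change s y.swap = (s y).swap
  rcases hs with ⟨i, j, hij, rfl⟩ | hs
  · have hne : i ≠ j := by rintro rfl; omega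
    rcases y with k | k <;> simp only [Equiv.Perm.mul_apply, Equiv.swap_apply_def, Sum.swap] <;>
      grind
  · cases X with
    | B | C =>
      obtain ⟨i, -, rfl⟩ := hs
      rcases y with k | k <;> simp only [Equiv.swap_apply_def, Sum.swap] <;> grind
    | D =>
      obtain ⟨i, j, hij, -, rfl⟩ := hs
      have hne : i ≠ j := by rintro rfl; omega
      rcases y with k | k <;> simp only [Equiv.Perm.mul_apply, Equiv.swap_apply_def, Sum.swap] <;>
        grind

/-- The value of `β`, extended to barred indices by `β_{j̄} = -β_j`, has the same absolute value
at `i` and at `ī`; as a signed permutation permutes the pairs `{i, ī}`, it preserves the norm. -/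
lemma sum_abs_act (X : CType) {n : ℕ} {w : Equiv.Perm (Fin n ⊕ Fin n)}
    (hw : w ∈ weylGroup X n) (β : Fin n → ℚ) : ∑ i, |act w β i| = ∑ i, |β i| := by
  -- Twice the norm is the sum over all `2n` indices, which any permutation preserves.
  let f : Fin n ⊕ Fin n → ℚ := Sum.elim β fun j => -β j
  have hswap : ∀ x, |f x.swap| = |f x| := by rintro (i | i) <;> simp [f]
  have hw' := swap_apply_of_mem_weylGroup X n (inv_mem hw)
  have hsum := Equiv.sum_comp w⁻¹ fun x => |f x|
  have hbar : ∀ i, |f (w⁻¹ (Sum.inr i))| = |f (w⁻¹ (Sum.inl i))| := fun i => by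
    rw [← hswap (w⁻¹ (Sum.inl i)), ← hw', Sum.swap_inl]
  simp only [Fintype.sum_sum_type, hbar] at hsum
  have hβ : ∑ i, |f (Sum.inr i)| = ∑ i, |f (Sum.inl i)| := by simp [f]
  rw [hβ] at hsum
  change ∑ i, |f (w⁻¹ (Sum.inl i))| = ∑ i, |f (Sum.inl i)|
  linarith

/-! ### The degree bound -/

lemma sum_abs_le_of_mem_rootDecompositions (X : CType) (n : ℕ) {β : Fin n → ℚ}
    {m : {α // α ∈ positiveRoots X n} → ℕ} (hm : m ∈ rootDecompositions X n β) :
    ∑ i, |β i| ≤ 2 * ((∑ α, m α : ℕ) : ℚ) := by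
  rw [← (show ∑ α, (m α : ℚ) • α.1 = β from hm)]
  calc ∑ i, |(∑ α, (m α : ℚ) • α.1) i| ≤ ∑ i, ∑ α, (m α : ℚ) * |α.1 i| := by
        refine Finset.sum_le_sum fun i _ => ?_
        rw [Finset.sum_apply]
        refine (Finset.abs_sum_le_sum_abs _ _).trans_eq (Finset.sum_congr rfl fun α _ => ?_)
        simp [abs_mul]
    _ = ∑ α, (m α : ℚ) * ∑ i, |α.1 i| := by
        rw [Finset.sum_comm]
        simp only [Finset.mul_sum]
    _ ≤ ∑ α, (m α : ℚ) * 2 := Finset.sum_le_sum fun α _ =>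
        mul_le_mul_of_nonneg_left (sum_abs_le_two X n α.2) (Nat.cast_nonneg _)
    _ = 2 * ((∑ α, m α : ℕ) : ℚ) := by
        rw [← Finset.sum_mul, mul_comm, Nat.cast_sum]

lemma sub_le_sum_abs_dotAct_sub (X : CType) {n : ℕ} {w : Equiv.Perm (Fin n ⊕ Fin n)}
    (hw : w ∈ weylGroup X n) {ν μ : Fin n → ℚ} (hν : 0 ≤ ν) (hμ : 0 ≤ μ) :
    ∑ i, ν i - ∑ i, μ i ≤ ∑ i, |(dotAct X w ν - μ) i| := by
  have hνρ : ∑ i, |act w (ν + rho X n) i| = ∑ i, ν i + ∑ i, rho X n i := by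
    rw [sum_abs_act X hw, ← Finset.sum_add_distrib]
    exact Finset.sum_congr rfl fun i _ => abs_of_nonneg (add_nonneg (hν i) (rho_nonneg X n i))
  have hμρ : ∑ i, |rho X n i + μ i| = ∑ i, rho X n i + ∑ i, μ i := by
    rw [← Finset.sum_add_distrib]
    exact Finset.sum_congr rfl fun i _ => abs_of_nonneg (add_nonneg (rho_nonneg X n i) (hμ i))
  have htri : ∑ i, (|act w (ν + rho X n) i| - |rho X n i + μ i|) ≤
      ∑ i, |(dotAct X w ν - μ) i| := by
    refine Finset.sum_le_sum fun i _ => ?_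
    rw [Pi.sub_apply, dotAct, Pi.sub_apply, sub_sub]
    exact abs_sub_abs_le_abs_sub _ _
  rw [Finset.sum_sub_distrib, hνρ, hμρ] at htri
  linarith

lemma exists_of_coeff_kostantPartition_ne_zero (X : CType) (n : ℕ) (β : Fin n → ℚ) {k : ℕ}
    (h : (kostantPartition X n β).coeff k ≠ 0) :
    ∃ m ∈ rootDecompositions X n β, ∑ α, m α = k := by
  rw [kostantPartition, finsetSum_coeff] at h
  obtain ⟨m, hm, hk⟩ := Finset.exists_ne_zero_of_sum_ne_zero h
  refine ⟨m, (Set.Finite.mem_toFinset _).1 hm, ?_⟩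
  by_contra hne
  exact hk (by rw [coeff_X_pow, if_neg (Ne.symm hne)])

lemma exists_of_coeff_lusztigQ_ne_zero (X : CType) (n : ℕ) (ν μ : Fin n → ℕ) {k : ℕ}
    (h : (lusztigQ X n ν μ).coeff k ≠ 0) :
    ∃ w ∈ weylGroup X n, (kostantPartition X n
      (dotAct X w (fun i => (ν i : ℚ)) - fun i => (μ i : ℚ))).coeff k ≠ 0 := by
  rw [lusztigQ, finsetSum_coeff] at h
  obtain ⟨w, -, hk⟩ := Finset.exists_ne_zero_of_sum_ne_zero h
  refine ⟨w.1, w.2, fun h0 => hk ?_⟩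
  rcases neg_one_pow_eq_or ℤ[X] (length X n w.1) with h1 | h1 <;> simp [h1, h0]

end ClassicalType

theorem mainTheorem9 (X : ClassicalType.CType) (n : ℕ) (hn : 1 ≤ n) (ν μ : Fin n → ℕ)
    (hν : Antitone ν) (hμ : Antitone μ) :
    ClassicalType.lusztigQ X n ν μ = 0 ∨
      ((∑ i, (ν i : ℚ)) - ∑ i, (μ i : ℚ)) / 2 ≤
        ((ClassicalType.lusztigQ X n ν μ).natTrailingDegree : ℚ) := by
  refine or_iff_not_imp_left.2 fun hK => ?_
  obtain ⟨w, hw, hk⟩ := ClassicalType.exists_of_coeff_lusztigQ_ne_zero X n ν μ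
    (Polynomial.trailingCoeff_nonzero_iff_nonzero.2 hK)
  obtain ⟨m, hm, hmk⟩ := ClassicalType.exists_of_coeff_kostantPartition_ne_zero X n _ hk
  have h1 := ClassicalType.sum_abs_le_of_mem_rootDecompositions X n hm
  have h2 := ClassicalType.sub_le_sum_abs_dotAct_sub X hw
    (ν := fun i => (ν i : ℚ)) (μ := fun i => (μ i : ℚ))
    (fun i => Nat.cast_nonneg (ν i)) (fun i => Nat.cast_nonneg (μ i))
  rw [hmk] at h1
  linarith
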